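/- All graphs are simple and undirected; they may be finite or infinite. First-order logic (FO) and monadic second-order logic (MSO) are taken over the signature with a single binary edge relation (and equality), so that MSO quantifies over vertices and over sets of vertices, but not over sets of edges. A class $\mathcal{C}$ of graphs is *hereditary* if every induced subgraph of a graph in $\mathcal{C}$ is again in $\mathcal{C}$. *MSO is more expressive than FO on* $\mathcal{C}$ if there is an MSO-sentence $\varphi$ such that for no FO-sentence $\psi$ one has $G \models \varphi \Leftrightarrow G \models \psi$ for all $G \in \mathcal{C}$. Let $G$ be a graph, $\mathcal{P}$ a partition of its vertex set, and $F \subseteq \mathcal{P}^2$ a symmetric relation. The *$\mathcal{P}$-flip* of $G$ given by $F$ is the graph on the same vertex set in which two distinct vertices $u \in P$, $v \in Q$ with $P, Q \in \mathcal{P}$ are adjacent if and only if either $(P,Q) \notin F$ and $uv \in E(G)$, or $(P,Q) \in F$ and $uv \notin E(G)$ (here $P = Q$ is allowed). For $t \in \mathbb{N}$: - The half-graph $H_t$ has vertices $a_1,\dots,a_t,b_1,\dots,b_t$, and its edges are the pairs $a_i b_j$ with $i \le j$. A *flipped $H_t$* is any $\{A,B\}$-flip of $H_t$, where $A = \{a_1,\dots,a_t\}$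 and $B = \{b_1,\dots,b_t\}$. - $tP_t$ is the disjoint union of $t$ paths with $t$ vertices each. A *flipped $tP_t$* is any $\mathcal{L}$-flip of $tP_t$, where $\mathcal{L} = \{L_1,\dots,L_t\}$ and $L_j$ consists of the $j$th vertices of all $t$ paths. **Proposition.** Let $\mathcal{C}$ be a hereditary class of graphs such that for every $t \in \mathbb{N}$, $\mathcal{C}$ contains, up to isomorphism, a flipped $H_t$ or a flipped $tP_t$. Then MSO is more expressive than FO on $\mathcal{C}$. -/

import Mathlib

universe u v w

/-! ### Monadic second-order logic -/

/-- Formulas of monadic second-order logic over the language `L`, with free element variables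
indexed by `Fin n` and free set variables indexed by `Fin m`; the first-order part is set up as
in `FirstOrder.Language.BoundedFormula`. -/
inductive MSOFormula (L : FirstOrder.Language.{u, v}) : ℕ → ℕ → Type (max u v)
  | falsum {n m : ℕ} : MSOFormula L n m
  | equal {n m : ℕ} (s t : L.Term (Fin n)) : MSOFormula L n m
  | rel {n m l : ℕ} (R : L.Relations l) (ts : Fin l → L.Term (Fin n)) : MSOFormula L n m
  | mem {n m : ℕ} (t : L.Term (Fin n)) (X : Fin m) : MSOFormula L n m
  | imp {n m : ℕ} (φ ψ : MSOFormula L n m) : MSOFormula L n m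
  | all {n m : ℕ} (φ : MSOFormula L (n + 1) m) : MSOFormula L n m
  | allSet {n m : ℕ} (φ : MSOFormula L n (m + 1)) : MSOFormula L n m

/-- Satisfaction of an MSO formula in a structure `M`, where the element variables have values
`x` and the set variables have values `X`. -/
def MSOFormula.Realize {L : FirstOrder.Language.{u, v}} {M : Type w} [L.Structure M] :
    {n m : ℕ} → MSOFormula L n m → (Fin n → M) → (Fin m → Set M) → Prop
  | _, _, .falsum, _, _ => False
  | _, _, .equal s t, x, _ => s.realize x = t.realize x
  | _, _, .rel R ts, x, _ => FirstOrder.Language.Structure.RelMap R fun i => (ts i).realize x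
  | _, _, .mem t i, x, X => t.realize x ∈ X i
  | _, _, .imp φ ψ, x, X => φ.Realize x X → ψ.Realize x X
  | _, _, .all φ, x, X => ∀ a : M, φ.Realize (Fin.snoc x a) X
  | _, _, .allSet φ, x, X => ∀ A : Set M, φ.Realize x (Fin.snoc X A)

/-- An MSO sentence: no free element variables and no free set variables. -/
abbrev MSOSentence (L : FirstOrder.Language.{u, v}) : Type (max u v) := MSOFormula L 0 0

/-- A graph satisfies a first-order sentence in the language of graphs. -/
def SimpleGraph.SatFO {V : Type w} (G : SimpleGraph V) (ψ : FirstOrder.Language.graph.Sentence) : Prop :=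
  @FirstOrder.Language.Sentence.Realize FirstOrder.Language.graph V G.structure ψ

/-- A graph satisfies an MSO sentence in the language of graphs (quantification over vertices and
over sets of vertices). -/
def SimpleGraph.SatMSO {V : Type w} (G : SimpleGraph V) (φ : MSOSentence FirstOrder.Language.graph) : Prop :=
  @MSOFormula.Realize FirstOrder.Language.graph V G.structure 0 0 φ Fin.elim0 Fin.elim0

/-! ### Graph classes -/

/-- A class of (finite or infinite) graphs. It may, but need not, be closed under isomorphism. -/
def GraphClass : Type (w + 1) := ∀ V : Type w, SimpleGraph V → Prop

/-- Closed under taking induced subgraphs. -/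
def GraphClass.Hereditary (C : GraphClass.{w}) : Prop :=
  ∀ (V : Type w) (G : SimpleGraph V) (s : Set V), C V G → C s (G.induce s)

/-- The class contains (a graph isomorphic to) `G`. -/
def GraphClass.Contains (C : GraphClass.{w}) {V : Type v} (G : SimpleGraph V) : Prop :=
  ∃ (W : Type w) (H : SimpleGraph W), C W H ∧ Nonempty (G ≃g H)

/-- Every MSO sentence is equivalent, on the graphs of the class, to a first-order sentence. -/
def GraphClass.SameExpressivePower (C : GraphClass.{w}) : Prop :=
  ∀ φ : MSOSentence FirstOrder.Language.graph, ∃ ψ : FirstOrder.Language.graph.Sentence,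
    ∀ (V : Type w) (G : SimpleGraph V), C V G → (G.SatMSO φ ↔ G.SatFO ψ)

/-- MSO is more expressive than FO on the class. -/
def GraphClass.MSOMoreExpressive (C : GraphClass.{w}) : Prop :=
  ¬ C.SameExpressivePower

/-! ### Flips, half-graphs and disjoint unions of paths -/

/-- The flip of `G` along the partition of the vertices into the fibres of `c`: the adjacency of
two distinct vertices is complemented exactly if their parts are related by `F`. -/
def SimpleGraph.flipParts {V : Type v} {ι : Type w} (G : SimpleGraph V) (c : V → ι)
    (F : ι → ι → Prop) (hF : ∀ i j, F i j → F j i) : SimpleGraph V where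
  Adj x y := x ≠ y ∧ ((F (c x) (c y) ∧ ¬ G.Adj x y) ∨ (¬ F (c x) (c y) ∧ G.Adj x y))
  symm := ⟨fun x y h => by
    refine ⟨h.1.symm, ?_⟩
    have hc : F (c y) (c x) ↔ F (c x) (c y) := ⟨hF _ _, hF _ _⟩
    rw [hc, G.adj_comm y x]
    exact h.2⟩
  loopless := ⟨fun _ h => h.1 rfl⟩

/-- `H` arises from `G` by a flip along the partition into the fibres of `c`. -/
def SimpleGraph.IsFlipOf {V : Type v} {ι : Type w} (H G : SimpleGraph V) (c : V → ι) : Prop :=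
  ∃ (F : ι → ι → Prop) (hF : ∀ i j, F i j → F j i), H = G.flipParts c F hF

/-- The half-graph of order `t`: `a i = Sum.inl i` and `b j = Sum.inr j` are adjacent iff
`i ≤ j`, and there are no other edges. -/
def halfGraph (t : ℕ) : SimpleGraph (Fin t ⊕ Fin t) where
  Adj
    | .inl i, .inr j => i ≤ j
    | .inr j, .inl i => i ≤ j
    | _, _ => False
  symm := ⟨by rintro (i | i) (j | j) h <;> exact h⟩
  loopless := ⟨by rintro (i | i) h <;> exact h⟩

/-- A flip of the half-graph of order `t` along the partition into the two sides. -/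
def IsFlippedHalfGraph (t : ℕ) (H : SimpleGraph (Fin t ⊕ Fin t)) : Prop :=
  H.IsFlipOf (halfGraph t) Sum.isLeft

/-- The disjoint union of `m` paths on `t` vertices each; `(i, j)` is the `j`th vertex on the
`i`th path. -/
def disjointPaths (m t : ℕ) : SimpleGraph (Fin m × Fin t) where
  Adj x y := x.1 = y.1 ∧ (SimpleGraph.pathGraph t).Adj x.2 y.2
  symm := ⟨fun _ _ h => ⟨h.1.symm, h.2.symm⟩⟩
  loopless := ⟨fun _ h => h.2.ne rfl⟩

/-- A flip of `m` disjoint paths on `t` vertices along the partition into the `t` layers, where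
the `j`th layer consists of the `j`th vertices of all the paths. -/
def IsFlippedDisjointPaths (m t : ℕ) (H : SimpleGraph (Fin m × Fin t)) : Prop :=
  H.IsFlipOf (disjointPaths m t) Prod.snd

/-!
# MSO is more expressive than FO on classes with large flipped patterns

For each of the two kinds of patterns there is one MSO property such that every FO sentence `ψ`
fails to express it as soon as the class contains a pattern of large order, compared with the
quantifier rank of `ψ`. If MSO collapsed to FO, a single pattern large enough for both properties
would therefore contradict the collapse. An MSO property is chosen that forces the number of
vertices to be divisible by some number, by asking for a definable matching of the vertices. Hence
it fails in a graph with the wrong number of vertices for trivial reasons, and no set variable has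
to be shown to have the intended value. The two graphs to be separated are taken from the induced
subgraphs of the same pattern, so that they carry the same flip.

*Half-graphs.* `HasQuartering` divides the vertices into four parts and asks that "`a i` and `b i`
of a half-graph" defines bijections between them, so the number of vertices is a multiple of four.
It holds in flipped half-graphs of even order (`hasQuartering_of_iso`) and fails for odd order. In
the Ehrenfeucht–Fraïssé game the half-graphs of large orders behave as long linear orders, which
agree on sentences of small quantifier rank (`satFO_flipParts_halfGraph_iff`).

*Disjoint paths.* A flip along many layers cannot be guessed by a bounded number of set variables,
but it can be undone by a formula (`exceptionalPair_flipParts_iff`): in a flip of a graph of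
maximum degree two along large parts, two vertices whose neighbourhoods differ in few places are
flipped in the same way, and `u`, `v` are adjacent in the original graph if and only if `u` is
related to most vertices flipped like `v` in another way than to `v`. `HasPairing` asks for a
perfect matching of the original graph, namely its edges inside one of two sets. For `t` odd, take
`N` paths without the last and `N` paths without the first vertex. All have even order, so a
pairing exists (`hasPairing_flipParts_truncatedPaths`). Adding a complete path makes the number of
vertices odd. A sentence of small quantifier rank does not notice this, even if it can see the
layers, since the start of the complete path looks like that of a path of the first kind, its end
like that of a path of the second kind (`satFO_flipParts_truncatedPaths_iff`).
-/

/-! ### Back-and-forth systems and first-order sentences -/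

/-- The quantifier rank of a first-order formula. -/
def FirstOrder.Language.BoundedFormula.quantifierRank {L : FirstOrder.Language.{u, v}}
    {α : Type w} : {n : ℕ} → L.BoundedFormula α n → ℕ
  | _, .falsum => 0
  | _, .equal _ _ => 0
  | _, .rel _ _ => 0
  | _, .imp φ ψ => max φ.quantifierRank ψ.quantifierRank
  | _, .all φ => φ.quantifierRank + 1

section BackAndForth

variable {V : Type u} {W : Type v} {G : SimpleGraph V} {H : SimpleGraph W}
  {R : ℕ → ∀ n : ℕ, (Fin n → V) → (Fin n → W) → Prop}

/-- In the language of graphs a term is a variable. -/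
theorem FirstOrder.Language.graph.exists_eq_var {α : Type w}
    (s : FirstOrder.Language.graph.Term α) :
    ∃ i, s = .var i := by
  cases s with
  | var i => exact ⟨i, rfl⟩
  | func f _ => exact f.elim

open FirstOrder Language in
theorem FirstOrder.Language.BoundedFormula.realize_iff_of_backAndForth
    (eq : ∀ k n x y, R k n x y → ∀ i j, x i = x j ↔ y i = y j)
    (adj : ∀ k n x y, R k n x y → ∀ i j, G.Adj (x i) (x j) ↔ H.Adj (y i) (y j))
    (forth : ∀ k n x y, R (k + 1) n x y → ∀ a, ∃ b, R k (n + 1) (Fin.snoc x a) (Fin.snoc y b))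
    (back : ∀ k n x y, R (k + 1) n x y → ∀ b, ∃ a, R k (n + 1) (Fin.snoc x a) (Fin.snoc y b))
    {n : ℕ} (φ : Language.graph.BoundedFormula Empty n) :
    ∀ (k : ℕ) (_ : φ.quantifierRank ≤ k) (x : Fin n → V) (y : Fin n → W), R k n x y →
      (@BoundedFormula.Realize _ V G.structure _ _ φ Empty.elim x ↔
        @BoundedFormula.Realize _ W H.structure _ _ φ Empty.elim y) := by
  induction φ with
  | falsum => intros; rfl
  | equal s t =>
    intro k _ x y h
    obtain ⟨i | i, rfl⟩ := graph.exists_eq_var s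
    · exact i.elim
    obtain ⟨j | j, rfl⟩ := graph.exists_eq_var t
    · exact j.elim
    exact eq k _ x y h i j
  | rel r ts =>
    intro k _ x y h
    cases r
    obtain ⟨i | i, hi⟩ := graph.exists_eq_var (ts 0)
    · exact i.elim
    obtain ⟨j | j, hj⟩ := graph.exists_eq_var (ts 1)
    · exact j.elim
    change G.Adj (@Term.realize _ V G.structure _ _ (ts 0))
        (@Term.realize _ V G.structure _ _ (ts 1)) ↔
      H.Adj (@Term.realize _ W H.structure _ _ (ts 0))
        (@Term.realize _ W H.structure _ _ (ts 1))
    rw [hi, hj]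
    exact adj k _ x y h i j
  | imp φ ψ ihφ ihψ =>
    intro k hk x y h
    exact imp_congr (ihφ k (le_trans (le_max_left _ _) hk) x y h)
      (ihψ k (le_trans (le_max_right _ _) hk) x y h)
  | all φ ih =>
    intro k hk x y h
    obtain ⟨k, rfl⟩ : ∃ l, k = l + 1 := ⟨k - 1, by simp only [quantifierRank] at hk; omega⟩
    have hk' : φ.quantifierRank ≤ k := by simpa [quantifierRank] using hk
    constructor
    · intro hx b
      obtain ⟨a, hab⟩ := back k _ x y h b
      exact (ih k hk' _ _ hab).1 (hx a)
    · intro hy a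
      obtain ⟨b, hab⟩ := forth k _ x y h a
      exact (ih k hk' _ _ hab).2 (hy b)

/-- Duplicator's winning strategy in the Ehrenfeucht–Fraïssé game: a back-and-forth system `R`
relating the empty tuples with `k` rounds to go makes two graphs agree on all sentences of
quantifier rank at most `k`. -/
theorem SimpleGraph.satFO_iff_of_backAndForth
    (eq : ∀ k n x y, R k n x y → ∀ i j, x i = x j ↔ y i = y j)
    (adj : ∀ k n x y, R k n x y → ∀ i j, G.Adj (x i) (x j) ↔ H.Adj (y i) (y j))
    (forth : ∀ k n x y, R (k + 1) n x y → ∀ a, ∃ b, R k (n + 1) (Fin.snoc x a) (Fin.snoc y b))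
    (back : ∀ k n x y, R (k + 1) n x y → ∀ b, ∃ a, R k (n + 1) (Fin.snoc x a) (Fin.snoc y b))
    (ψ : FirstOrder.Language.graph.Sentence) {k : ℕ} (hk : ψ.quantifierRank ≤ k)
    (h : ∀ x y, R k 0 x y) : G.SatFO ψ ↔ H.SatFO ψ := by
  have := FirstOrder.Language.BoundedFormula.realize_iff_of_backAndForth eq adj forth back ψ k hk
    default default (h _ _)
  unfold SimpleGraph.SatFO FirstOrder.Language.Sentence.Realize FirstOrder.Language.Formula.Realize
  convert this

end BackAndForth

theorem SimpleGraph.Iso.satFO_iff {V : Type u} {W : Type v} {G : SimpleGraph V} {H : SimpleGraph W}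
    (e : G ≃g H) (ψ : FirstOrder.Language.graph.Sentence) : G.SatFO ψ ↔ H.SatFO ψ := by
  refine SimpleGraph.satFO_iff_of_backAndForth (R := fun _ _ x y => ∀ i, y i = e (x i))
    ?_ ?_ ?_ ?_ ψ le_rfl fun _ _ i => i.elim0
  · intro _ _ x y h i j
    simp [h]
  · intro _ _ x y h i j
    rw [h, h]
    exact e.map_adj_iff.symm
  · intro _ n x y h a
    refine ⟨e a, Fin.lastCases (by simp) fun i => by simp [h]⟩
  · intro _ n x y h b
    refine ⟨e.symm b, Fin.lastCases (by simp) fun i => by simp [h]⟩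

/-! ### Definability in monadic second-order logic -/

/-- A property of tuples of vertices and of sets of vertices in graphs is definable if some MSO
formula expresses it uniformly in all graphs. -/
def MSODefinable (n m : ℕ)
    (P : ∀ V : Type w, SimpleGraph V → (Fin n → V) → (Fin m → Set V) → Prop) : Prop :=
  ∃ φ : MSOFormula FirstOrder.Language.graph n m, ∀ (V : Type w) (G : SimpleGraph V) x X,
    @MSOFormula.Realize _ V G.structure n m φ x X ↔ P V G x X

namespace MSODefinable

variable {n m : ℕ} {P Q : ∀ V : Type w, SimpleGraph V → (Fin n → V) → (Fin m → Set V) → Prop}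

theorem congr (h : MSODefinable n m P) (hPQ : ∀ V G x X, P V G x X ↔ Q V G x X) :
    MSODefinable n m Q :=
  let ⟨φ, hφ⟩ := h
  ⟨φ, fun V G x X => (hφ V G x X).trans (hPQ V G x X)⟩

theorem eq (i j : Fin n) : MSODefinable.{w} n m fun _ _ x _ => x i = x j :=
  ⟨.equal (.var i) (.var j), fun _ _ _ _ => Iff.rfl⟩

theorem adj (i j : Fin n) : MSODefinable.{w} n m fun _ G x _ => G.Adj (x i) (x j) :=
  ⟨.rel FirstOrder.Language.adj ![.var i, .var j], fun _ _ _ _ => Iff.rfl⟩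

theorem mem (i : Fin n) (a : Fin m) : MSODefinable.{w} n m fun _ _ x X => x i ∈ X a :=
  ⟨.mem (.var i) a, fun _ _ _ _ => Iff.rfl⟩

theorem imp (hP : MSODefinable n m P) (hQ : MSODefinable n m Q) :
    MSODefinable n m fun V G x X => P V G x X → Q V G x X :=
  let ⟨φ, hφ⟩ := hP
  let ⟨ψ, hψ⟩ := hQ
  ⟨.imp φ ψ, fun V G x X => imp_congr (hφ V G x X) (hψ V G x X)⟩

theorem not (hP : MSODefinable n m P) : MSODefinable n m fun V G x X => ¬ P V G x X :=
  hP.imp ⟨.falsum, fun _ _ _ _ => Iff.rfl⟩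

theorem and (hP : MSODefinable n m P) (hQ : MSODefinable n m Q) :
    MSODefinable n m fun V G x X => P V G x X ∧ Q V G x X :=
  (hP.imp hQ.not).not.congr fun _ _ _ _ => by tauto

theorem or (hP : MSODefinable n m P) (hQ : MSODefinable n m Q) :
    MSODefinable n m fun V G x X => P V G x X ∨ Q V G x X :=
  (hP.not.imp hQ).congr fun _ _ _ _ => by tauto

theorem iff (hP : MSODefinable n m P) (hQ : MSODefinable n m Q) :
    MSODefinable n m fun V G x X => (P V G x X ↔ Q V G x X) :=
  ((hP.imp hQ).and (hQ.imp hP)).congr fun _ _ _ _ => by tauto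

theorem all {P : ∀ V : Type w, SimpleGraph V → (Fin n → V) → (Fin m → Set V) → V → Prop}
    (h : MSODefinable (n + 1) m fun V G x X => P V G (fun i => x i.castSucc) X (x (Fin.last n))) :
    MSODefinable n m fun V G x X => ∀ a, P V G x X a := by
  obtain ⟨φ, hφ⟩ := h
  exact ⟨.all φ, fun V G x X => forall_congr' fun a => (hφ V G _ X).trans <| by simp⟩

theorem ex {P : ∀ V : Type w, SimpleGraph V → (Fin n → V) → (Fin m → Set V) → V → Prop}
    (h : MSODefinable (n + 1) m fun V G x X => P V G (fun i => x i.castSucc) X (x (Fin.last n))) :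
    MSODefinable n m fun V G x X => ∃ a, P V G x X a :=
  (all (P := fun V G x X a => ¬ P V G x X a) h.not).not.congr fun _ _ _ _ => by simp

theorem exSet {P : ∀ V : Type w, SimpleGraph V → (Fin n → V) → (Fin m → Set V) → Set V → Prop}
    (h : MSODefinable n (m + 1) fun V G x X => P V G x (fun i => X i.castSucc) (X (Fin.last m))) :
    MSODefinable n m fun V G x X => ∃ A, P V G x X A := by
  obtain ⟨φ, hφ⟩ := h.not
  refine MSODefinable.congr (P := fun V G x X => ¬ ∀ A, ¬ P V G x X A) (not ⟨.allSet φ, ?_⟩) ?_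
  · exact fun V G x X => forall_congr' fun A => (hφ V G x _).trans <| by simp
  · simp

end MSODefinable

/-! ### Half-graphs are first-order indistinguishable -/

/-- The correspondence `S` between integers preserves distances cut off at `2 ^ k`, and in
particular the order. The range of `d` is invariant under `d ↦ -d - 1`, so that negating the
inequalities gives the same condition with the two pairs exchanged. -/
def DistPreserving (k : ℕ) (S : Set (ℤ × ℤ)) : Prop :=
  ∀ p ∈ S, ∀ q ∈ S, ∀ d : ℤ, -2 ^ k ≤ d → d < 2 ^ k → (p.1 ≤ q.1 + d ↔ p.2 ≤ q.2 + d)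

namespace DistPreserving

variable {k : ℕ} {S : Set (ℤ × ℤ)}

theorem swap (h : DistPreserving k S) : DistPreserving k (Prod.swap ⁻¹' S) :=
  fun p hp q hq d h₁ h₂ => (h _ hp _ hq d h₁ h₂).symm

theorem le_iff (h : DistPreserving k S) {p q : ℤ × ℤ} (hp : p ∈ S) (hq : q ∈ S) :
    p.1 ≤ q.1 ↔ p.2 ≤ q.2 := by
  simpa using h p hp q hq 0 (by simp) (by positivity)

theorem mono (h : DistPreserving (k + 1) S) : DistPreserving k S := by
  intro p hp q hq d h₁ h₂
  refine h p hp q hq d ?_ ?_ <;> rw [pow_succ] <;> linarith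

theorem insert_of_forall (h : DistPreserving k S) {p : ℤ × ℤ}
    (hp : ∀ q ∈ S, ∀ d : ℤ, -2 ^ k ≤ d → d < 2 ^ k → (p.1 ≤ q.1 + d ↔ p.2 ≤ q.2 + d)) :
    DistPreserving k (insert p S) := by
  rintro q (rfl | hq) r (rfl | hr) d h₁ h₂
  · simp
  · exact hp r hr d h₁ h₂
  · have := hp q hq (-d - 1) (by linarith) (by linarith)
    omega
  · exact h q hq r hr d h₁ h₂

/-- The forth step of the game on long linear orders: a point close to an old one is answered at the
same distance, and a point far from all old ones is answered at the cut-off distance above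
the next smaller old one. -/
theorem exists_insert (h : DistPreserving (k + 1) S) (hS : S.Finite) {p q : ℤ × ℤ}
    (hp : p ∈ S) (hq : q ∈ S) {a : ℤ} (hpa : p.1 < a) (haq : a < q.1) :
    ∃ b, p.2 < b ∧ b < q.2 ∧ DistPreserving k (insert (a, b) S) := by
  have key : ∃ b, DistPreserving k (insert (a, b) S) := by
    by_cases hc : ∃ r ∈ S, |a - r.1| ≤ 2 ^ k
    · obtain ⟨r, hr, har⟩ := hc
      rw [abs_le] at har
      refine ⟨r.2 + (a - r.1), h.mono.insert_of_forall fun s hs d h₁ h₂ => ?_⟩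
      have := h r hr s hs (d - (a - r.1)) (by rw [pow_succ]; linarith) (by rw [pow_succ]; linarith)
      constructor <;> intro _ <;> dsimp only at * <;> omega
    · push Not at hc
      obtain ⟨r, ⟨hr, hra⟩, hmax⟩ :=
        (hS.subset (Set.sep_subset S fun r => r.1 < a)).exists_maximalFor Prod.fst _ ⟨p, hp, hpa⟩
      refine ⟨r.2 + 2 ^ k, h.mono.insert_of_forall fun s hs d h₁ h₂ => ?_⟩
      have h2 : (2 : ℤ) ^ (k + 1) = 2 ^ k + 2 ^ k := by ring
      have hk : (0 : ℤ) < 2 ^ k := by positivity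
      dsimp only
      by_cases hsa : s.1 < a
      · have hsr : s.1 ≤ r.1 := by
          by_contra hlt
          exact hlt (hmax ⟨hs, hsa⟩ (by omega))
        have := (h.le_iff hs hr).1 hsr
        have := hc s hs
        rw [abs_of_pos (by omega)] at this
        constructor <;> intro _ <;> omega
      · have h3 := hc s hs
        rw [abs_of_nonpos (by omega)] at h3
        have h4 := hc r hr
        rw [abs_of_pos (by omega)] at h4
        have := h s hs r hr (2 ^ (k + 1) - 1) (by omega) (by omega)
        constructor <;> intro _ <;> omega
  obtain ⟨b, hb⟩ := key
  refine ⟨b, ?_, ?_, hb⟩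
  · have := hb.le_iff (Set.mem_insert _ _) (Set.mem_insert_of_mem _ hp)
    dsimp only at this
    omega
  · have := hb.le_iff (Set.mem_insert_of_mem _ hq) (Set.mem_insert _ _)
    dsimp only at this
    omega

end DistPreserving

/-- The index of a vertex of the half-graph, on either side. -/
def halfGraphIndex {t : ℕ} : Fin t ⊕ Fin t → ℤ :=
  Sum.elim (fun i => i) fun i => i

theorem exists_halfGraphIndex_eq {t : ℕ} (s : Bool) {b : ℤ} (h₀ : -1 < b) (h₁ : b < t) :
    ∃ v : Fin t ⊕ Fin t, v.isLeft = s ∧ halfGraphIndex v = b := by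
  lift b to ℕ using by omega
  cases s
  · exact ⟨.inr ⟨b, by omega⟩, rfl, rfl⟩
  · exact ⟨.inl ⟨b, by omega⟩, rfl, rfl⟩

theorem halfGraphIndex_bounds {t : ℕ} (v : Fin t ⊕ Fin t) :
    -1 < halfGraphIndex v ∧ halfGraphIndex v < t := by
  rcases v with i | i <;> simp only [halfGraphIndex, Sum.elim_inl, Sum.elim_inr] <;> omega

theorem halfGraph_adj_iff {t : ℕ} (u v : Fin t ⊕ Fin t) : (halfGraph t).Adj u v ↔
    (u.isLeft = true ∧ v.isLeft = false ∧ halfGraphIndex u ≤ halfGraphIndex v) ∨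
    (u.isLeft = false ∧ v.isLeft = true ∧ halfGraphIndex v ≤ halfGraphIndex u) := by
  rcases u with i | i <;> rcases v with j | j <;> simp [halfGraph, halfGraphIndex]

theorem halfGraph_ext_iff {t : ℕ} (u v : Fin t ⊕ Fin t) :
    u = v ↔ u.isLeft = v.isLeft ∧ halfGraphIndex u = halfGraphIndex v := by
  rcases u with i | i <;> rcases v with j | j <;> simp [halfGraphIndex, Fin.ext_iff]

/-- The positions in the game on two half-graphs from which Duplicator can survive `k` rounds:
sides agree, and the indices, with the two bounds of the index sets added, have
the same distances up to `2 ^ k`. -/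
def HalfGraphGame (t t' k n : ℕ) (x : Fin n → Fin t ⊕ Fin t) (y : Fin n → Fin t' ⊕ Fin t') : Prop :=
  (∀ i, (x i).isLeft = (y i).isLeft) ∧ ∃ S : Set (ℤ × ℤ), S.Finite ∧ (-1, -1) ∈ S ∧
    ((t : ℤ), (t' : ℤ)) ∈ S ∧ DistPreserving k S ∧
      ∀ i, (halfGraphIndex (x i), halfGraphIndex (y i)) ∈ S

namespace HalfGraphGame

variable {t t' k n : ℕ} {x : Fin n → Fin t ⊕ Fin t} {y : Fin n → Fin t' ⊕ Fin t'}

theorem swap (h : HalfGraphGame t t' k n x y) : HalfGraphGame t' t k n y x := by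
  obtain ⟨h₀, S, hfin, h₁, h₂, hS, h₃⟩ := h
  exact ⟨fun i => (h₀ i).symm, Prod.swap ⁻¹' S, hfin.preimage Prod.swap_injective.injOn, h₁, h₂,
    hS.swap, h₃⟩

theorem exists_snoc (h : HalfGraphGame t t' (k + 1) n x y) (a : Fin t ⊕ Fin t) :
    ∃ b, HalfGraphGame t t' k (n + 1) (Fin.snoc x a) (Fin.snoc y b) := by
  obtain ⟨h₀, S, hfin, h₁, h₂, hS, h₃⟩ := h
  obtain ⟨b, hb₀, hb₁, hb⟩ := hS.exists_insert hfin h₁ h₂ (halfGraphIndex_bounds a).1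
    (halfGraphIndex_bounds a).2
  obtain ⟨b, hside, rfl⟩ := exists_halfGraphIndex_eq a.isLeft hb₀ hb₁
  refine ⟨b, Fin.lastCases (by simp [hside]) fun i => by simp [h₀], _, hfin.insert _,
    Set.mem_insert_of_mem _ h₁, Set.mem_insert_of_mem _ h₂, hb, Fin.lastCases (by simp) fun i => ?_⟩
  simpa using Or.inr (h₃ i)

theorem index_le_iff (h : HalfGraphGame t t' k n x y) (i j : Fin n) :
    halfGraphIndex (x i) ≤ halfGraphIndex (x j) ↔ halfGraphIndex (y i) ≤ halfGraphIndex (y j) := by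
  obtain ⟨-, S, -, -, -, hS, h₃⟩ := h
  exact hS.le_iff (h₃ i) (h₃ j)

theorem eq_iff (h : HalfGraphGame t t' k n x y) (i j : Fin n) : x i = x j ↔ y i = y j := by
  rw [halfGraph_ext_iff, halfGraph_ext_iff, h.1, h.1, and_congr_right_iff]
  have h₁ := h.index_le_iff i j
  have h₂ := h.index_le_iff j i
  omega

theorem adj_iff (h : HalfGraphGame t t' k n x y) (F : Bool → Bool → Prop)
    (hF : ∀ i j, F i j → F j i) (i j : Fin n) :
    ((halfGraph t).flipParts Sum.isLeft F hF).Adj (x i) (x j) ↔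
      ((halfGraph t').flipParts Sum.isLeft F hF).Adj (y i) (y j) := by
  simp only [SimpleGraph.flipParts, halfGraph_adj_iff, ne_eq, h.eq_iff, h.1, h.index_le_iff]

theorem zero (ht : 2 ^ k ≤ t) (ht' : 2 ^ k ≤ t') (x y) : HalfGraphGame t t' k 0 x y := by
  refine ⟨fun i => i.elim0, {(-1, -1), ((t : ℤ), (t' : ℤ))}, by simp, by simp, by simp, ?_,
    fun i => i.elim0⟩
  zify at ht ht'
  rintro p (rfl | rfl) q (rfl | rfl) d h₁ h₂
  · simp
  · constructor <;> intro _ <;> dsimp only <;> linarith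
  · constructor <;> intro h <;> dsimp only at * <;> linarith
  · simp

end HalfGraphGame

/-- Half-graphs of large order, flipped in the same way, agree on sentences of bounded quantifier
rank, whatever their orders are. -/
theorem satFO_flipParts_halfGraph_iff (F : Bool → Bool → Prop) (hF : ∀ i j, F i j → F j i)
    (ψ : FirstOrder.Language.graph.Sentence) {t t' : ℕ} (ht : 2 ^ ψ.quantifierRank ≤ t)
    (ht' : 2 ^ ψ.quantifierRank ≤ t') :
    ((halfGraph t).flipParts Sum.isLeft F hF).SatFO ψ ↔
      ((halfGraph t').flipParts Sum.isLeft F hF).SatFO ψ := by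
  refine SimpleGraph.satFO_iff_of_backAndForth (R := HalfGraphGame t t')
    (fun _ _ _ _ h => h.eq_iff) (fun _ _ _ _ h => h.adj_iff F hF)
    (fun _ _ _ _ h => h.exists_snoc) (fun _ _ _ _ h b => ?_) ψ le_rfl (.zero ht ht')
  obtain ⟨a, ha⟩ := h.swap.exists_snoc b
  exact ⟨a, ha.swap⟩

/-! ### The half-graph certificate -/

/-- `u ∈ S` and `v ∈ T` are matched along `r` if they are related and no `u' ∈ S`, `v' ∈ T`
with `r u v'`, `r u' v` are unrelated. In a half-graph these are the pairs
`a i`, `b i`. -/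
def MatchedAlong {V : Type u} (r : V → V → Prop) (S T : Set V) (u v : V) : Prop :=
  r u v ∧ ∀ u', u' ∈ S → ∀ v', v' ∈ T → r u v' → r u' v → r u' v'

/-- Being matched along `r` is a one-to-one correspondence between `S` and `T`. -/
def MatchesSets {V : Type u} (r : V → V → Prop) (S T : Set V) : Prop :=
  (∀ u, u ∈ S → ∃ v, v ∈ T ∧ MatchedAlong r S T u v ∧
    ∀ v', v' ∈ T → MatchedAlong r S T u v' → v' = v) ∧
  (∀ v, v ∈ T → ∃ u, u ∈ S ∧ MatchedAlong r S T u v ∧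
    ∀ u', u' ∈ S → MatchedAlong r S T u' v → u' = u)

theorem MatchesSets.ncard_eq {V : Type u} [Finite V] {r : V → V → Prop} {S T : Set V}
    (h : MatchesSets r S T) : S.ncard = T.ncard := by
  choose! f hf₁ hf₂ hf₃ using h.1
  choose! g hg₁ hg₂ hg₃ using h.2
  refine Set.ncard_congr (fun u _ => f u) hf₁ (fun u v hu hv huv => ?_) fun v hv =>
    ⟨g v, hg₁ v hv, (hf₃ _ (hg₁ v hv) v hv (hg₂ v hv)).symm⟩
  rw [hg₃ (f v) (hf₁ v hv) v hv (hf₂ v hv)]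
  exact hg₃ _ (hf₁ v hv) u hu (huv ▸ hf₂ u hu)

theorem matchesSets_range {V : Type u} {r : V → V → Prop} {m : ℕ} {a b : Fin m → V}
    (hr : ∀ i j, r (a i) (b j) ↔ i ≤ j) : MatchesSets r (Set.range a) (Set.range b) := by
  have key : ∀ i j, MatchedAlong r (Set.range a) (Set.range b) (a i) (b j) ↔ i = j := by
    intro i j
    constructor
    · rintro ⟨h₁, h₂⟩
      rw [hr] at h₁
      refine le_antisymm h₁ ?_
      rw [← hr]
      exact h₂ _ ⟨j, rfl⟩ _ ⟨i, rfl⟩ ((hr _ _).2 le_rfl) ((hr _ _).2 le_rfl)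
    · rintro rfl
      refine ⟨(hr _ _).2 le_rfl, ?_⟩
      rintro _ ⟨j, rfl⟩ _ ⟨l, rfl⟩ h₁ h₂
      rw [hr] at *
      exact h₂.trans h₁
  constructor
  · rintro _ ⟨i, rfl⟩
    refine ⟨b i, ⟨i, rfl⟩, (key _ _).2 rfl, ?_⟩
    rintro _ ⟨j, rfl⟩ h
    rw [(key _ _).1 h]
  · rintro _ ⟨i, rfl⟩
    refine ⟨a i, ⟨i, rfl⟩, (key _ _).2 rfl, ?_⟩
    rintro _ ⟨j, rfl⟩ h
    rw [(key _ _).1 h]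

/-- The set `Q` compensates for a flip between the two sides of a half-graph. -/
def flippedRel {V : Type u} (G : SimpleGraph V) (Q : Set V) (u v : V) : Prop :=
  G.Adj u v ↔ u ∈ Q

/-- The MSO property that tells half-graphs of even order from those of odd order: the vertex set is
divided by two sets `A` and `D` into four parts that are matched to one another. -/
def HasQuartering {V : Type u} (G : SimpleGraph V) : Prop :=
  ∃ A D Q : Set V, MatchesSets (flippedRel G Q) (A ∩ D) (Aᶜ ∩ D) ∧
    MatchesSets (flippedRel G Q) (A ∩ D) (Aᶜ ∩ Dᶜ) ∧
    MatchesSets (flippedRel G Q) (A ∩ Dᶜ) (Aᶜ ∩ Dᶜ)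

theorem HasQuartering.four_dvd_card {V : Type u} [Finite V] {G : SimpleGraph V}
    (h : HasQuartering G) : 4 ∣ Nat.card V := by
  obtain ⟨A, D, Q, h₁, h₂, h₃⟩ := h
  have h₁ := h₁.ncard_eq
  have h₂ := h₂.ncard_eq
  have h₃ := h₃.ncard_eq
  have hA := Set.ncard_inter_add_ncard_sdiff_eq_ncard A D (Set.toFinite _)
  have hA' := Set.ncard_inter_add_ncard_sdiff_eq_ncard Aᶜ D (Set.toFinite _)
  rw [Set.sdiff_eq] at hA hA'
  have := Set.ncard_add_ncard_compl A
  omega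

theorem msoDefinable_hasQuartering :
    MSODefinable.{w} 0 0 fun _ G _ _ => HasQuartering G := by
  unfold HasQuartering MatchesSets MatchedAlong flippedRel
  simp only [Set.mem_inter_iff, Set.mem_compl_iff]
  repeat' first
    | with_reducible apply MSODefinable.exSet
    | with_reducible apply MSODefinable.and
    | with_reducible apply MSODefinable.iff
    | with_reducible apply MSODefinable.ex
    | with_reducible apply MSODefinable.eq
    | with_reducible apply MSODefinable.adj
    | with_reducible apply MSODefinable.mem
    | with_reducible apply MSODefinable.not
    | with_reducible apply MSODefinable.imp
    | with_reducible apply MSODefinable.all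

theorem hasQuartering_of_iso {V : Type u} {G : SimpleGraph V} {m : ℕ} (F : Bool → Bool → Prop)
    (hF : ∀ i j, F i j → F j i)
    (e : G ≃g (halfGraph (2 * m)).flipParts Sum.isLeft F hF) : HasQuartering G := by
  classical
  -- `Q` is empty or everything, according to whether the flip exchanges edges and non-edges
  -- between the sides; flips inside a side do not matter.
  have hr : ∀ i j, flippedRel G {_u | ¬ F true false} (e.symm (.inl i)) (e.symm (.inr j)) ↔
      i ≤ j := by
    intro i j
    unfold flippedRel
    rw [e.symm.map_adj_iff]
    by_cases h : F true false <;> simp [SimpleGraph.flipParts, h, halfGraph]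
  let c (l : Fin m) : Fin (2 * m) := ⟨2 * l, by omega⟩
  let c' (l : Fin m) : Fin (2 * m) := ⟨2 * l + 1, by omega⟩
  have hc : ∀ i : Fin (2 * m), Even (i : ℕ) ↔ ∃ l, c l = i := by
    intro i
    simp only [c, Fin.ext_iff]
    exact ⟨fun ⟨l, hl⟩ => ⟨⟨l, by omega⟩, by dsimp only; omega⟩, fun ⟨l, hl⟩ => ⟨l, by omega⟩⟩
  have hc' : ∀ i : Fin (2 * m), ¬ Even (i : ℕ) ↔ ∃ l, c' l = i := by
    intro i
    simp only [c', Fin.ext_iff, Nat.not_even_iff_odd]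
    exact ⟨fun ⟨l, hl⟩ => ⟨⟨l, by omega⟩, by dsimp only; omega⟩, fun ⟨l, hl⟩ => ⟨l, by omega⟩⟩
  -- `A` is the first side and `D` consists of the vertices of even index.
  -- `A` is the first side and `D` consists of the vertices of even index.
  -- `A` is the first side and `D` consists of the vertices of even index.
  let A : Set V := {v | (e v).isLeft = true}
  let D : Set V := {v | Even (Sum.elim Fin.val Fin.val (e v))}
  have h₁ : A ∩ D = Set.range fun l => e.symm (.inl (c l)) := by
    ext v
    obtain ⟨i | i, rfl⟩ := e.symm.surjective v <;> simp [A, D, hc, Set.mem_range]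
  have h₂ : A ∩ Dᶜ = Set.range fun l => e.symm (.inl (c' l)) := by
    ext v
    obtain ⟨i | i, rfl⟩ := e.symm.surjective v <;>
      simp [A, D, hc', Set.mem_range, -Nat.not_even_iff_odd]
  have h₃ : Aᶜ ∩ D = Set.range fun l => e.symm (.inr (c l)) := by
    ext v
    obtain ⟨i | i, rfl⟩ := e.symm.surjective v <;> simp [A, D, hc, Set.mem_range]
  have h₄ : Aᶜ ∩ Dᶜ = Set.range fun l => e.symm (.inr (c' l)) := by
    ext v
    obtain ⟨i | i, rfl⟩ := e.symm.surjective v <;>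
      simp [A, D, hc', Set.mem_range, -Nat.not_even_iff_odd]
  refine ⟨A, D, {_u | ¬ F true false}, ?_, ?_, ?_⟩
  · rw [h₁, h₃]
    exact matchesSets_range fun i j => by
      rw [hr]
      change 2 * (i : ℕ) ≤ 2 * j ↔ (i : ℕ) ≤ j
      omega
  · rw [h₁, h₄]
    exact matchesSets_range fun i j => by
      rw [hr]
      change 2 * (i : ℕ) ≤ 2 * j + 1 ↔ (i : ℕ) ≤ j
      omega
  · rw [h₂, h₄]
    exact matchesSets_range fun i j => by
      rw [hr]
      change 2 * (i : ℕ) + 1 ≤ 2 * j + 1 ↔ (i : ℕ) ≤ j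
      omega

/-! ### Undoing flips of sparse graphs -/

/-- The property `Q` holds for all but at most six vertices. Six is the number of exceptions
caused by two vertices and their neighbours in a graph of maximum degree two. -/
def AllButSix {V : Type u} (Q : V → Prop) : Prop :=
  ∃ w₁ w₂ w₃ w₄ w₅ w₆, ∀ w, Q w ∨ w = w₁ ∨ w = w₂ ∨ w = w₃ ∨ w = w₄ ∨ w = w₅ ∨ w = w₆

theorem AllButSix.exists_finset {V : Type u} {Q : V → Prop} (h : AllButSix Q) :
    ∃ s : Finset V, s.card ≤ 6 ∧ ∀ w ∉ s, Q w := by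
  classical
  obtain ⟨w₁, w₂, w₃, w₄, w₅, w₆, h⟩ := h
  refine ⟨{w₁, w₂, w₃, w₄, w₅, w₆}, Finset.card_le_six, fun w hw => (h w).resolve_right ?_⟩
  simpa using hw

/-- Two vertices have the same neighbours with at most six exceptions. -/
def AlmostTwins {V : Type u} (G : SimpleGraph V) (u v : V) : Prop :=
  AllButSix fun w => G.Adj u w ↔ G.Adj v w

/-- The adjacency of `u` and `v` is exceptional: only few almost-twins of `v` are related to `u`
in the same way as `v`. -/
def ExceptionalPair {V : Type u} (G : SimpleGraph V) (u v : V) : Prop :=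
  ¬ u = v ∧ AllButSix fun w => AlmostTwins G w v → ¬ (G.Adj u w ↔ G.Adj u v)

section Unflip

variable {V : Type u} {ι : Type v} {P : SimpleGraph V} {c : V → ι} {F : ι → ι → Prop}
  {hF : ∀ i j, F i j → F j i} {f g : V → V}

theorem flipParts_adj_iff {u v : V} (huv : u ≠ v) :
    (P.flipParts c F hF).Adj u v ↔ (P.Adj u v ↔ ¬ F (c u) (c v)) := by
  simp only [SimpleGraph.flipParts, ne_eq, huv, not_false_eq_true, true_and]
  tauto

/-- In a flip of a graph of maximum degree two along large parts, two vertices are almost-twins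
if and only if their parts are flipped with the same parts. -/
theorem almostTwins_flipParts_iff (hP : ∀ u w, P.Adj u w → w = f u ∨ w = g u)
    (hc : ∀ v (s : Finset V), s.card ≤ 12 → ∃ w ∉ s, c w = c v) (u v : V) :
    AlmostTwins (P.flipParts c F hF) u v ↔ ∀ w, F (c u) (c w) ↔ F (c v) (c w) := by
  classical
  have adj : ∀ u w, w ≠ u → w ≠ f u → w ≠ g u →
      ((P.flipParts c F hF).Adj u w ↔ F (c u) (c w)) := by
    intro u w h₀ h₁ h₂
    have : ¬ P.Adj u w := fun h => (hP u w h).elim h₁ h₂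
    rw [flipParts_adj_iff h₀.symm]
    tauto
  constructor
  · intro h w
    obtain ⟨s, hs, h⟩ := h.exists_finset
    obtain ⟨x, hx, hxw⟩ := hc w (s ∪ {u, f u, g u, v, f v, g v})
      ((Finset.card_union_le _ _).trans (Nat.add_le_add hs Finset.card_le_six))
    simp only [Finset.mem_union, Finset.mem_insert, Finset.mem_singleton, not_or] at hx
    obtain ⟨hxs, h₁, h₂, h₃, h₄, h₅, h₆⟩ := hx
    have := h x hxs
    rwa [adj u x h₁ h₂ h₃, adj v x h₄ h₅ h₆, hxw] at this
  · intro h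
    refine ⟨u, f u, g u, v, f v, g v, fun w => ?_⟩
    by_cases hw : w = u ∨ w = f u ∨ w = g u ∨ w = v ∨ w = f v ∨ w = g v
    · exact .inr hw
    · refine .inl ?_
      simp only [not_or] at hw
      obtain ⟨h₁, h₂, h₃, h₄, h₅, h₆⟩ := hw
      rw [adj u w h₁ h₂ h₃, adj v w h₄ h₅ h₆, h]

/-- Flips of a graph of maximum degree two along large parts can be undone, without
knowledge of the parts or of the flip. -/
theorem exceptionalPair_flipParts_iff (hP : ∀ u w, P.Adj u w → w = f u ∨ w = g u)
    (hc : ∀ v (s : Finset V), s.card ≤ 12 → ∃ w ∉ s, c w = c v) (u v : V) :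
    ExceptionalPair (P.flipParts c F hF) u v ↔ P.Adj u v := by
  classical
  have hsymm : ∀ i j, F i j ↔ F j i := fun i j => ⟨hF i j, hF j i⟩
  simp only [ExceptionalPair, almostTwins_flipParts_iff hP hc]
  constructor
  · rintro ⟨huv, h⟩
    by_contra hadj
    obtain ⟨s, hs, h⟩ := h.exists_finset
    obtain ⟨x, hx, hxv⟩ := hc v (s ∪ {u, f u, g u})
      ((Finset.card_union_le _ _).trans ((add_le_add hs Finset.card_le_three).trans (by norm_num)))
    simp only [Finset.mem_union, Finset.mem_insert, Finset.mem_singleton, not_or] at hx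
    obtain ⟨hxs, h₁, h₂, h₃⟩ := hx
    have hadj' : ¬ P.Adj u x := fun h => (hP u x h).elim h₂ h₃
    refine h x hxs (fun w => by rw [hxv]) ?_
    rw [flipParts_adj_iff huv, flipParts_adj_iff (Ne.symm h₁), hxv]
    tauto
  · intro hadj
    refine ⟨hadj.ne, u, f u, g u, u, f u, g u, fun w => ?_⟩
    by_cases hw : w = u ∨ w = f u ∨ w = g u
    · tauto
    · simp only [not_or] at hw
      obtain ⟨h₁, h₂, h₃⟩ := hw
      refine .inl fun htwin => ?_
      have hadj' : ¬ P.Adj u w := fun h => (hP u w h).elim h₂ h₃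
      have := htwin u
      rw [hsymm, hsymm (c v)] at this
      rw [flipParts_adj_iff hadj.ne, flipParts_adj_iff (Ne.symm h₁)]
      tauto

end Unflip

/-! ### The pairing certificate -/

/-- The MSO property that tells apart the flipped linear forests: some set `X` makes each vertex
exceptional with exactly one vertex on the same side of `X`. -/
def HasPairing {V : Type u} (G : SimpleGraph V) : Prop :=
  ∃ X : Set V, ∀ u, ∃ v, (ExceptionalPair G u v ∧ ExceptionalPair G v u ∧ (u ∈ X ↔ v ∈ X)) ∧
    ∀ v', ExceptionalPair G u v' ∧ ExceptionalPair G v' u ∧ (u ∈ X ↔ v' ∈ X) → v' = v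

theorem HasPairing.even_card {V : Type u} [Finite V] {G : SimpleGraph V} (h : HasPairing G) :
    Even (Nat.card V) := by
  have := Fintype.ofFinite V
  obtain ⟨X, hX⟩ := h
  let K : SimpleGraph V :=
    { Adj u v := ExceptionalPair G u v ∧ ExceptionalPair G v u ∧ (u ∈ X ↔ v ∈ X)
      symm := ⟨fun _ _ h => ⟨h.2.1, h.1, h.2.2.symm⟩⟩
      loopless := ⟨fun _ h => h.1.1 rfl⟩ }
  have hK : (⊤ : K.Subgraph).IsPerfectMatching :=
    SimpleGraph.Subgraph.isPerfectMatching_iff.2 fun u => by simpa [ExistsUnique, K] using hX u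
  rw [Nat.card_eq_fintype_card]
  exact hK.even_card

theorem msoDefinable_hasPairing : MSODefinable.{w} 0 0 fun _ G _ _ => HasPairing G := by
  unfold HasPairing ExceptionalPair AlmostTwins AllButSix
  repeat' first
    | with_reducible apply MSODefinable.exSet
    | with_reducible apply MSODefinable.and
    | with_reducible apply MSODefinable.or
    | with_reducible apply MSODefinable.iff
    | with_reducible apply MSODefinable.ex
    | with_reducible apply MSODefinable.eq
    | with_reducible apply MSODefinable.adj
    | with_reducible apply MSODefinable.mem
    | with_reducible apply MSODefinable.not
    | with_reducible apply MSODefinable.imp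
    | with_reducible apply MSODefinable.all

/-! ### Truncated paths -/

/-- The first `m` of the paths, where the paths with index below `N` lose their last vertex and
those with index from `N` to `2 * N - 1` lose their first vertex. The path with index `2 * N`, which
belongs to the set if `2 * N < m`, is complete. -/
def truncatedPaths (N t m : ℕ) : Set (Fin t × Fin t) :=
  {x | (x.1 : ℕ) < m ∧ ((x.2 : ℕ) = 0 → (x.1 : ℕ) < N ∨ (x.1 : ℕ) = 2 * N) ∧
    ((x.2 : ℕ) + 1 = t → N ≤ (x.1 : ℕ))}

theorem disjointPaths_adj_iff {m t : ℕ} (x y : Fin m × Fin t) : (disjointPaths m t).Adj x y ↔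
    x.1 = y.1 ∧ ((x.2 : ℕ) + 1 = y.2 ∨ (y.2 : ℕ) + 1 = x.2) := by
  simp only [disjointPaths, SimpleGraph.pathGraph_adj]

section Truncated

variable {V : Type u} {N t m : ℕ} {c : V → Fin t × Fin t}

/-- Paths have maximum degree two. -/
theorem exists_forall_adj_comap_disjointPaths (hc : Function.Injective c) :
    ∃ f g : V → V, ∀ u w, ((disjointPaths t t).comap c).Adj u w → w = f u ∨ w = g u := by
  have h₁ : ∀ u, ∃ w, ∀ w', (c u).1 = (c w').1 → ((c u).2 : ℕ) + 1 = (c w').2 → w' = w := by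
    intro u
    by_cases h : ∃ w, (c u).1 = (c w).1 ∧ ((c u).2 : ℕ) + 1 = (c w).2
    · obtain ⟨w, h₁, h₂⟩ := h
      exact ⟨w, fun w' h₁' h₂' => hc (Prod.ext (by rw [← h₁, h₁']) (Fin.ext (by omega)))⟩
    · push Not at h
      exact ⟨u, fun w' h₁' h₂' => (h w' h₁' h₂').elim⟩
  have h₂ : ∀ u, ∃ w, ∀ w', (c u).1 = (c w').1 → ((c w').2 : ℕ) + 1 = (c u).2 → w' = w := by
    intro u
    by_cases h : ∃ w, (c u).1 = (c w).1 ∧ ((c w).2 : ℕ) + 1 = (c u).2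
    · obtain ⟨w, h₁, h₂⟩ := h
      exact ⟨w, fun w' h₁' h₂' => hc (Prod.ext (by rw [← h₁, h₁']) (Fin.ext (by omega)))⟩
    · push Not at h
      exact ⟨u, fun w' h₁' h₂' => (h w' h₁' h₂').elim⟩
  choose f hf using h₁
  choose g hg using h₂
  refine ⟨f, g, fun u w h => ?_⟩
  rw [SimpleGraph.comap_adj, disjointPaths_adj_iff] at h
  exact h.2.imp (hf u w h.1) (hg u w h.1)

/-- An interval of `N` paths contains one that avoids fewer than `N` given ones. -/
theorem exists_mem_Ico_notMem (a : ℕ) {N : ℕ} {s : Finset ℕ} (hs : s.card < N) :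
    ∃ p, a ≤ p ∧ p < a + N ∧ p ∉ s := by
  obtain ⟨p, hp, hps⟩ := Finset.exists_mem_notMem_of_card_lt_card
    (s := s) (t := Finset.Ico a (a + N)) (by simpa using hs)
  rw [Finset.mem_Ico] at hp
  exact ⟨p, hp.1, hp.2, hps⟩

/-- All layers of the truncated paths have at least `N` vertices: the first `N` paths keep the first
layer, and the next `N` paths keep all others. -/
theorem exists_notMem_layer_eq (hN : 13 ≤ N) (hNt : 2 * N ≤ t) (hm : 2 * N ≤ m)
    (hr : Set.range c = truncatedPaths N t m) (v : V) (s : Finset V) (hs : s.card ≤ 12) :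
    ∃ w ∉ s, (c w).2 = (c v).2 := by
  classical
  have hs' : (s.image fun w => ((c w).1 : ℕ)).card < N :=
    (Finset.card_image_le.trans hs).trans_lt (by omega)
  have key : ∀ p, (hp : p < 2 * N) → (((c v).2 : ℕ) = 0 → p < N) →
      (((c v).2 : ℕ) + 1 = t → N ≤ p) → p ∉ s.image (fun w => ((c w).1 : ℕ)) →
      ∃ w ∉ s, (c w).2 = (c v).2 := by
    intro p hp h₀ h₁ hps
    obtain ⟨w, hw⟩ : (⟨⟨p, by omega⟩, (c v).2⟩ : Fin t × Fin t) ∈ Set.range c := by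
      rw [hr]
      exact ⟨by dsimp only; omega, fun h => .inl (h₀ h), h₁⟩
    refine ⟨w, fun hws => hps (Finset.mem_image.2 ⟨w, hws, ?_⟩), ?_⟩ <;> rw [hw]
  by_cases hv : ((c v).2 : ℕ) = 0
  · obtain ⟨p, -, hp, hps⟩ := exists_mem_Ico_notMem 0 hs'
    exact key p (by omega) (by omega) (by omega) hps
  · obtain ⟨p, hp₀, hp, hps⟩ := exists_mem_Ico_notMem N hs'
    exact key p (by omega) (by omega) (by omega) hps

/-- If all truncated paths have an even number `t - 1` of vertices, these can be paired along the
paths, starting from the first vertex of each path. Deciding membership in `X` by the parity of the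
number of the pair separates the pairs of a path. -/
theorem hasPairing_flipParts_truncatedPaths (hN : 13 ≤ N) (hNt : 2 * N ≤ t) (ht : Odd t)
    (hc : Function.Injective c) (hr : Set.range c = truncatedPaths N t (2 * N))
    (F : Fin t → Fin t → Prop) (hF : ∀ i j, F i j → F j i) :
    HasPairing (((disjointPaths t t).comap c).flipParts (fun v => (c v).2) F hF) := by
  obtain ⟨f, g, hfg⟩ := exists_forall_adj_comap_disjointPaths hc
  have hmem : ∀ v, c v ∈ truncatedPaths N t (2 * N) := fun v => hr ▸ ⟨v, rfl⟩
  -- `β v` is the number of the pair of `v` on its path, up to a shift of the layers by one.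
  -- `β v` is the number of the pair of `v` on its path, up to a shift of the layers by one.
  -- `β v` is the number of the pair of `v` on its path, up to a shift of the layers by one.
  let β (v : V) : ℕ := if ((c v).1 : ℕ) < N then (c v).2 / 2 else ((c v).2 + 1) / 2
  refine ⟨{v | Even (β v)}, fun u => ?_⟩
  simp only [exceptionalPair_flipParts_iff hfg (exists_notMem_layer_eq hN hNt le_rfl hr),
    SimpleGraph.comap_adj, disjointPaths_adj_iff, Set.mem_ofPred_eq]
  obtain ⟨hu₁, hu₂, hu₃⟩ := hmem u
  have hlt := (c u).2.isLt
  obtain ⟨k, hk⟩ := ht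
  have key : ∀ j, (hj : j < t) → (((c u).2 : ℕ) + 1 = j ∨ j + 1 = (c u).2) →
      (((c u).1 : ℕ) < N → (c u).2 / 2 = j / 2) →
      (N ≤ ((c u).1 : ℕ) → ((c u).2 + 1) / 2 = (j + 1) / 2) → ∃ v, c v = ⟨(c u).1, ⟨j, hj⟩⟩ := by
    intro j hj h₁ h₂ h₃
    change _ ∈ Set.range c
    rw [hr]
    refine ⟨hu₁, ?_, ?_⟩ <;> dsimp only <;> omega
  have main : ∃ j, ∃ hj : j < t, (((c u).2 : ℕ) + 1 = j ∨ j + 1 = (c u).2) ∧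
      (((c u).1 : ℕ) < N → (c u).2 / 2 = j / 2) ∧
      (N ≤ ((c u).1 : ℕ) → ((c u).2 + 1) / 2 = (j + 1) / 2) := by
    by_cases hb : ((c u).1 : ℕ) < N ↔ ((c u).2 : ℕ) % 2 = 0
    · refine ⟨(c u).2 + 1, ?_, .inl rfl, ?_, ?_⟩ <;> omega
    · refine ⟨(c u).2 - 1, ?_, .inr ?_, ?_, ?_⟩ <;> omega
  obtain ⟨j, hj, h₁, h₂, h₃⟩ := main
  obtain ⟨v, hv⟩ := key j hj h₁ h₂ h₃
  have hβ : ∀ v', (c u).1 = (c v').1 →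
      (((c u).2 : ℕ) + 1 = (c v').2 ∨ ((c v').2 : ℕ) + 1 = (c u).2) →
      ((Even (β u) ↔ Even (β v')) ↔ (c v').2 = (c v).2) := by
    intro v' hp hl
    simp only [β, ← hp, hv, Fin.ext_iff, Nat.even_iff]
    split_ifs <;> omega
  have hv₁ : (c u).1 = (c v).1 := by rw [hv]
  have hv₂ : ((c u).2 : ℕ) + 1 = (c v).2 ∨ ((c v).2 : ℕ) + 1 = (c u).2 := by rw [hv]; exact h₁
  refine ⟨v, ⟨⟨hv₁, hv₂⟩, ⟨hv₁.symm, hv₂.symm⟩, (hβ v hv₁ hv₂).2 rfl⟩, ?_⟩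
  rintro v' ⟨⟨h₁', h₂'⟩, -, h₃'⟩
  exact hc (Prod.ext (h₁'.symm.trans hv₁) ((hβ v' h₁' h₂').1 h₃'))

theorem ncard_truncatedPaths_even (hN : 13 ≤ N) (hNt : 2 * N ≤ t) (ht : Odd t) :
    Even (truncatedPaths N t (2 * N)).ncard :=
  -- The trivial flip gives a pairing on this set itself.
  -- The trivial flip gives a pairing on this set itself.
  -- The trivial flip gives a pairing on this set itself.
  (hasPairing_flipParts_truncatedPaths (c := ((↑) : truncatedPaths N t (2 * N) → _)) hN hNt ht
    Subtype.val_injective Subtype.range_coe (fun _ _ => False) (fun _ _ h => h)).even_card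

/-- The complete path makes the number of vertices odd. -/
theorem ncard_truncatedPaths_odd (hN : 13 ≤ N) (hNt : 2 * N < t) (ht : Odd t) :
    Odd (truncatedPaths N t (2 * N + 1)).ncard := by
  let b (j : Fin t) : Fin t × Fin t := ⟨⟨2 * N, hNt⟩, j⟩
  have hunion : truncatedPaths N t (2 * N + 1) = truncatedPaths N t (2 * N) ∪ Set.range b := by
    ext ⟨i, j⟩
    have hij : (i, j) ∈ Set.range b ↔ (i : ℕ) = 2 * N :=
      ⟨fun ⟨_, h⟩ => congrArg (fun x => (x.1 : ℕ)) h.symm, fun h => ⟨j, by simp [b, ← h]⟩⟩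
    simp only [truncatedPaths, Set.mem_ofPred_eq, Set.mem_union, hij]
    omega
  have hdisj : Disjoint (truncatedPaths N t (2 * N)) (Set.range b) := by
    rw [Set.disjoint_right]
    rintro _ ⟨j, rfl⟩ h
    exact lt_irrefl _ h.1
  have hb : (Set.range b).ncard = t := by
    rw [← Set.image_univ, Set.ncard_image_of_injective _ fun i j h => congrArg Prod.snd h,
      Set.ncard_univ, Nat.card_eq_fintype_card, Fintype.card_fin]
  rw [hunion, Set.ncard_union_eq hdisj, hb]
  exact (ncard_truncatedPaths_even hN hNt.le ht).add_odd ht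

end Truncated

/-! ### Truncated paths are first-order indistinguishable -/

/-- The positions in the game on two sets of truncated paths from which Duplicator can survive
`k` rounds. Layers agree, vertices in layers at distance at most `2 ^ k` are on the same path on one
side if and only if they are on the other side, and near the first and the last layer the paths
agree on whether they contain a vertex of that layer. As `2 ^ (k + 1) + 1 < t`, no vertex is near
both. -/
def TruncatedPathsGame {V : Type u} {W : Type v} {t : ℕ} (N : ℕ) (c : V → Fin t × Fin t)
    (d : W → Fin t × Fin t) (k n : ℕ) (x : Fin n → V) (y : Fin n → W) : Prop :=
  n + k ≤ N ∧ 2 ^ (k + 1) + 1 < t ∧ (∀ i, (c (x i)).2 = (d (y i)).2) ∧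
  (∀ i, ((c (x i)).2 : ℕ) ≤ 2 ^ k →
    (((c (x i)).1 : ℕ) < N ∨ ((c (x i)).1 : ℕ) = 2 * N ↔
      ((d (y i)).1 : ℕ) < N ∨ ((d (y i)).1 : ℕ) = 2 * N)) ∧
  (∀ i, t ≤ ((c (x i)).2 : ℕ) + 2 ^ k + 1 → (N ≤ ((c (x i)).1 : ℕ) ↔ N ≤ ((d (y i)).1 : ℕ))) ∧
  ∀ i j, ((c (x i)).2 : ℕ) ≤ (c (x j)).2 + 2 ^ k → ((c (x j)).2 : ℕ) ≤ (c (x i)).2 + 2 ^ k →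
    ((c (x i)).1 = (c (x j)).1 ↔ (d (y i)).1 = (d (y j)).1)

namespace TruncatedPathsGame

variable {V : Type u} {W : Type v} {N t k n m : ℕ} {c : V → Fin t × Fin t} {d : W → Fin t × Fin t}
  {x : Fin n → V} {y : Fin n → W}

theorem swap (h : TruncatedPathsGame N c d k n x y) : TruncatedPathsGame N d c k n y x := by
  obtain ⟨h₁, h₂, h₃, h₄, h₅, h₆⟩ := h
  refine ⟨h₁, h₂, fun i => (h₃ i).symm, fun i hi => ?_, fun i hi => ?_, fun i j hi hj => ?_⟩
  · exact (h₄ i (by rwa [h₃])).symm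
  · exact (h₅ i (by rwa [h₃])).symm
  · exact (h₆ i j (by rwa [h₃, h₃]) (by rwa [h₃, h₃])).symm

theorem eq_iff (hc : Function.Injective c) (hd : Function.Injective d)
    (h : TruncatedPathsGame N c d k n x y) (i j : Fin n) : x i = x j ↔ y i = y j := by
  obtain ⟨-, -, h₃, -, -, h₆⟩ := h
  rw [← hc.eq_iff, ← hd.eq_iff, Prod.ext_iff, Prod.ext_iff, ← h₃, ← h₃, and_comm,
    and_comm (a := (d (y i)).1 = _)]
  refine and_congr_right fun hl => h₆ i j ?_ ?_ <;> rw [hl] <;> exact Nat.le_add_right _ _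

theorem adj_iff (hc : Function.Injective c) (hd : Function.Injective d)
    (h : TruncatedPathsGame N c d k n x y) (F : Fin t → Fin t → Prop) (hF : ∀ i j, F i j → F j i)
    (i j : Fin n) :
    (((disjointPaths t t).comap c).flipParts (fun v => (c v).2) F hF).Adj (x i) (x j) ↔
      (((disjointPaths t t).comap d).flipParts (fun v => (d v).2) F hF).Adj (y i) (y j) := by
  have heq := h.eq_iff hc hd i j
  obtain ⟨-, -, h₃, -, -, h₆⟩ := h
  have hk : 1 ≤ 2 ^ k := Nat.one_le_two_pow
  have hpath : (disjointPaths t t).Adj (c (x i)) (c (x j)) ↔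
      (disjointPaths t t).Adj (d (y i)) (d (y j)) := by
    rw [disjointPaths_adj_iff, disjointPaths_adj_iff, ← h₃, ← h₃]
    refine and_congr_left fun hl => h₆ i j ?_ ?_ <;> omega
  simp only [SimpleGraph.flipParts, SimpleGraph.comap_adj, ne_eq, heq, hpath, h₃]

/-- The forth step. A vertex close to an old one on the same path is answered on the path of the old
one's answer. For any other vertex a fresh path is taken, of the kind prescribed by the first or the
last layer if the vertex is near it. -/
theorem exists_snoc (hNt : 2 * N ≤ t) (hm : 2 * N ≤ m)
    (hc : ∀ v, (((c v).2 : ℕ) = 0 → ((c v).1 : ℕ) < N ∨ ((c v).1 : ℕ) = 2 * N) ∧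
      (((c v).2 : ℕ) + 1 = t → N ≤ ((c v).1 : ℕ)))
    (hd : Set.range d = truncatedPaths N t m)
    (h : TruncatedPathsGame N c d (k + 1) n x y) (a : V) :
    ∃ b, TruncatedPathsGame N c d k (n + 1) (Fin.snoc x a) (Fin.snoc y b) := by
  classical
  obtain ⟨h₁, h₂, h₃, h₄, h₅, h₆⟩ := h
  have hd' : ∀ w, ((d w).1 : ℕ) < m := fun w =>
    (show d w ∈ truncatedPaths N t m from hd ▸ ⟨w, rfl⟩).1
  obtain ⟨hca₀, hca₁⟩ := hc a
  rw [pow_succ, pow_succ] at h₂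
  simp only [pow_succ] at h₄ h₅ h₆
  have hk : 1 ≤ 2 ^ k := Nat.one_le_two_pow
  have hlt := (c a).2.isLt
  suffices key : ∃ q : Fin t, (q : ℕ) < m ∧
      (((c a).2 : ℕ) ≤ 2 ^ k → (((c a).1 : ℕ) < N ∨ ((c a).1 : ℕ) = 2 * N ↔
        (q : ℕ) < N ∨ (q : ℕ) = 2 * N)) ∧
      (t ≤ ((c a).2 : ℕ) + 2 ^ k + 1 → (N ≤ ((c a).1 : ℕ) ↔ N ≤ (q : ℕ))) ∧
      ∀ j, ((c a).2 : ℕ) ≤ (c (x j)).2 + 2 ^ k → ((c (x j)).2 : ℕ) ≤ (c a).2 + 2 ^ k →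
        ((c a).1 = (c (x j)).1 ↔ q = (d (y j)).1) by
    obtain ⟨q, hqm, hq₀, hq₁, hq⟩ := key
    obtain ⟨b, hb⟩ : (⟨q, (c a).2⟩ : Fin t × Fin t) ∈ Set.range d := by
      rw [hd]
      exact ⟨hqm, fun h => (hq₀ (by dsimp only at h; omega)).1 (hca₀ h),
        fun h => (hq₁ (by dsimp only at h; omega)).1 (hca₁ h)⟩
    refine ⟨b, by omega, by rw [pow_succ]; omega, ?_, ?_, ?_, ?_⟩
    · refine Fin.lastCases ?_ fun i => ?_
      · simp [hb]
      · simpa using h₃ i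
    · refine Fin.lastCases ?_ fun i => ?_
      · simpa [hb] using hq₀
      · simpa using fun hi => h₄ i (by omega)
    · refine Fin.lastCases ?_ fun i => ?_
      · simpa [hb] using hq₁
      · simpa using fun hi => h₅ i (by omega)
    · refine Fin.lastCases (Fin.lastCases ?_ fun j => ?_) fun i => Fin.lastCases ?_ fun j => ?_
      · simp
      · simpa [hb] using hq j
      · simpa [hb, eq_comm] using fun h₁ h₂ => hq i h₂ h₁
      · simpa using fun hi hj => h₆ i j (by omega) (by omega)
  by_cases hclose : ∃ i, (c a).1 = (c (x i)).1 ∧ ((c a).2 : ℕ) ≤ (c (x i)).2 + 2 ^ k ∧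
      ((c (x i)).2 : ℕ) ≤ (c a).2 + 2 ^ k
  · obtain ⟨i, hp, hl₁, hl₂⟩ := hclose
    refine ⟨(d (y i)).1, hd' _, fun hl => ?_, fun hl => ?_, fun j hj₁ hj₂ => ?_⟩
    · rw [hp]
      exact h₄ i (by omega)
    · rw [hp]
      exact h₅ i (by omega)
    · rw [hp]
      exact h₆ i j (by omega) (by omega)
  · push Not at hclose
    let s : Finset ℕ := Finset.univ.image fun i => ((d (y i)).1 : ℕ)
    have hs : s.card < N := by
      have : s.card ≤ n := Finset.card_image_le.trans (by simp)
      omega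
    obtain ⟨q, hq, hqs, hq₀, hq₁⟩ : ∃ q, q < 2 * N ∧ q ∉ s ∧ (((c a).2 : ℕ) ≤ 2 ^ k →
        (((c a).1 : ℕ) < N ∨ ((c a).1 : ℕ) = 2 * N ↔ q < N ∨ q = 2 * N)) ∧
        (t ≤ ((c a).2 : ℕ) + 2 ^ k + 1 → (N ≤ ((c a).1 : ℕ) ↔ N ≤ q)) := by
      obtain ⟨p, -, hp, hps⟩ := exists_mem_Ico_notMem 0 hs
      obtain ⟨p', hp₀', hp', hps'⟩ := exists_mem_Ico_notMem N hs
      by_cases hl : ((c a).2 : ℕ) ≤ 2 ^ k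
      · by_cases hN : ((c a).1 : ℕ) < N ∨ ((c a).1 : ℕ) = 2 * N
        · exact ⟨p, by omega, hps, by omega, by omega⟩
        · exact ⟨p', by omega, hps', by omega, by omega⟩
      · by_cases hN : N ≤ ((c a).1 : ℕ)
        · exact ⟨p', by omega, hps', by omega, by omega⟩
        · exact ⟨p, by omega, hps, by omega, by omega⟩
    refine ⟨⟨q, by omega⟩, by dsimp only; omega, hq₀, hq₁, fun j hj₁ hj₂ => ?_⟩
    refine iff_of_false (fun hp => ?_) fun hp => hqs ?_
    · have := hclose j hp hj₁
      omega
    · exact Finset.mem_image.2 ⟨j, Finset.mem_univ _, by rw [← hp]⟩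

end TruncatedPathsGame

/-- Truncated paths agree on sentences of small quantifier rank, with and without the complete
path and however the layers are flipped. -/
theorem satFO_flipParts_truncatedPaths_iff {V : Type u} {W : Type v} {N t m m' : ℕ}
    {c : V → Fin t × Fin t} {d : W → Fin t × Fin t}
    (hNt : 2 * N ≤ t) (hm : 2 * N ≤ m) (hm' : 2 * N ≤ m')
    (hc : Function.Injective c) (hd : Function.Injective d)
    (hcr : Set.range c = truncatedPaths N t m) (hdr : Set.range d = truncatedPaths N t m')
    (F : Fin t → Fin t → Prop) (hF : ∀ i j, F i j → F j i)
    (ψ : FirstOrder.Language.graph.Sentence) (hψN : ψ.quantifierRank ≤ N)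
    (hψt : 2 ^ (ψ.quantifierRank + 1) + 1 < t) :
    (((disjointPaths t t).comap c).flipParts (fun v => (c v).2) F hF).SatFO ψ ↔
      (((disjointPaths t t).comap d).flipParts (fun v => (d v).2) F hF).SatFO ψ := by
  have hc' : ∀ v, c v ∈ truncatedPaths N t m := fun v => hcr ▸ ⟨v, rfl⟩
  have hd' : ∀ v, d v ∈ truncatedPaths N t m' := fun v => hdr ▸ ⟨v, rfl⟩
  refine SimpleGraph.satFO_iff_of_backAndForth (R := TruncatedPathsGame N c d)
    (fun _ _ _ _ h => h.eq_iff hc hd) (fun _ _ _ _ h => h.adj_iff hc hd F hF)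
    (fun _ _ _ _ h => h.exists_snoc hNt hm' (fun v => (hc' v).2) hdr) (fun _ _ _ _ h b => ?_)
    ψ le_rfl fun _ _ => ⟨by omega, hψt, fun i => i.elim0, fun i => i.elim0, fun i => i.elim0,
      fun i => i.elim0⟩
  obtain ⟨a, ha⟩ := h.swap.exists_snoc hNt hm (fun v => (hd' v).2) hcr b
  exact ⟨a, ha.swap⟩

/-! ### Separating MSO from FO -/

theorem GraphClass.Hereditary.contains_of_embedding {C : GraphClass.{w}} (hC : C.Hereditary)
    {V : Type u} {V' : Type v} {G : SimpleGraph V} {G' : SimpleGraph V'} (hG : C.Contains G)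
    (f : G' ↪g G) : C.Contains G' := by
  obtain ⟨W, H, hH, ⟨e⟩⟩ := hG
  let g : G' ↪g H := f.trans e.toEmbedding
  exact ⟨_, _, hC W H (Set.range g) hH,
    ⟨⟨Equiv.ofInjective g g.injective, fun {a b} => g.map_adj_iff⟩⟩⟩

/-- A half-graph of smaller order is an induced subgraph, also after flipping. -/
def halfGraphEmbedding {r t : ℕ} (h : r ≤ t) (F : Bool → Bool → Prop)
    (hF : ∀ i j, F i j → F j i) :
    (halfGraph r).flipParts Sum.isLeft F hF ↪g (halfGraph t).flipParts Sum.isLeft F hF where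
  toFun := Sum.map (Fin.castLE h) (Fin.castLE h)
  inj' := (Fin.castLE_injective h).sumMap (Fin.castLE_injective h)
  map_rel_iff' {a b} := by
    rcases a with i | i <;> rcases b with j | j <;> simp [SimpleGraph.flipParts, halfGraph]

/-- If `t` is large enough, a class containing a flipped half-graph of order `t` contains, for each
`ψ`, two graphs that agree on `ψ` but not on having a quartering. -/
theorem not_forall_hasQuartering_iff_satFO {C : GraphClass.{w}} (hC : C.Hereditary)
    (ψ : FirstOrder.Language.graph.Sentence) {m : ℕ} (hm : 2 ^ ψ.quantifierRank < m)
    {H : SimpleGraph (Fin (2 * m) ⊕ Fin (2 * m))} (hH : IsFlippedHalfGraph (2 * m) H)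
    (hCH : C.Contains H) :
    ¬ ∀ (V : Type w) (G : SimpleGraph V), C V G → (HasQuartering G ↔ G.SatFO ψ) := by
  intro hψ
  obtain ⟨F, hF, rfl⟩ := hH
  have hpos : 0 < 2 ^ ψ.quantifierRank := by positivity
  obtain ⟨V', G', hG', ⟨e'⟩⟩ := hC.contains_of_embedding hCH
    (halfGraphEmbedding (show 2 * m - 1 ≤ 2 * m by omega) F hF)
  obtain ⟨V, G, hG, ⟨e⟩⟩ := hCH
  have h₁ : HasQuartering G := hasQuartering_of_iso F hF e.symm
  rw [hψ V G hG, ← e.satFO_iff, satFO_flipParts_halfGraph_iff F hF ψ (t' := 2 * m - 1) (by omega)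
    (by omega), e'.satFO_iff, ← hψ V' G' hG'] at h₁
  have : Finite V' := .of_equiv _ e'.toEquiv
  have h₂ := h₁.four_dvd_card
  rw [← Nat.card_congr e'.toEquiv, Nat.card_eq_fintype_card, Fintype.card_sum,
    Fintype.card_fin] at h₂
  omega

/-- The truncated paths that occur in a class containing flipped disjoint paths. -/
theorem GraphClass.Hereditary.exists_truncatedPaths {C : GraphClass.{w}} (hC : C.Hereditary)
    {t : ℕ} (F : Fin t → Fin t → Prop) (hF : ∀ i j, F i j → F j i)
    (hCH : C.Contains ((disjointPaths t t).flipParts Prod.snd F hF)) (N m : ℕ) :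
    ∃ (V : Type w) (c : V → Fin t × Fin t), Function.Injective c ∧
      Set.range c = truncatedPaths N t m ∧
      C V (((disjointPaths t t).comap c).flipParts (fun v => (c v).2) F hF) := by
  obtain ⟨V, G, hG, ⟨e⟩⟩ := hC.contains_of_embedding hCH
    (SimpleGraph.Embedding.induce (truncatedPaths N t m))
  refine ⟨V, fun v => (e.symm v : Fin t × Fin t),
    Subtype.val_injective.comp e.symm.injective, ?_, ?_⟩
  · rw [show (fun v => (e.symm v : Fin t × Fin t)) = Subtype.val ∘ e.symm from rfl,
      Set.range_comp, e.symm.surjective.range_eq, Set.image_univ, Subtype.range_coe]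
  · convert hG
    ext u v
    have huv : e.symm u = e.symm v ↔ u = v := e.symm.toEquiv.injective.eq_iff
    rw [← e.symm.map_adj_iff]
    simp only [SimpleGraph.flipParts, SimpleGraph.comap_adj, Function.Embedding.subtype_apply]
    exact and_congr_left fun _ => not_congr (Subtype.ext_iff.symm.trans huv).symm

/-- If `t` is large enough, a class containing flipped disjoint paths of length `t` contains, for
each `ψ`, two graphs that agree on `ψ` but not on having a pairing. -/
theorem not_forall_hasPairing_iff_satFO {C : GraphClass.{w}} (hC : C.Hereditary)
    (ψ : FirstOrder.Language.graph.Sentence) {t : ℕ} (ht : Odd t)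
    (hψ₁ : 2 ^ (ψ.quantifierRank + 1) + 1 < t) (hψ₂ : 2 * (ψ.quantifierRank + 13) < t)
    {H : SimpleGraph (Fin t × Fin t)} (hH : IsFlippedDisjointPaths t t H) (hCH : C.Contains H) :
    ¬ ∀ (V : Type w) (G : SimpleGraph V), C V G → (HasPairing G ↔ G.SatFO ψ) := by
  intro hψ
  obtain ⟨F, hF, rfl⟩ := hH
  generalize hN : ψ.quantifierRank + 13 = N at hψ₂
  obtain ⟨V, c, hc, hcr, hCV⟩ := hC.exists_truncatedPaths F hF hCH N (2 * N)
  obtain ⟨W, d, hd, hdr, hCW⟩ := hC.exists_truncatedPaths F hF hCH N (2 * N + 1)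
  have h₁ := hasPairing_flipParts_truncatedPaths (by omega) hψ₂.le ht hc hcr F hF
  rw [hψ _ _ hCV, satFO_flipParts_truncatedPaths_iff hψ₂.le le_rfl (Nat.le_succ _) hc hd hcr hdr
    F hF ψ (by omega) hψ₁, ← hψ _ _ hCW] at h₁
  have : Finite W := .of_injective d hd
  have h₂ := h₁.even_card
  rw [← Set.ncard_univ, ← Set.ncard_image_of_injective _ hd, Set.image_univ, hdr] at h₂
  exact Nat.not_even_iff_odd.2 (ncard_truncatedPaths_odd (by omega) hψ₂ ht) h₂

/-- On a class where MSO collapses to FO, every definable property of graphs is expressed by an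
FO sentence. -/
theorem GraphClass.SameExpressivePower.exists_satFO_iff {C : GraphClass.{w}}
    (h : C.SameExpressivePower) {P : ∀ V : Type w, SimpleGraph V → Prop}
    (hP : MSODefinable 0 0 fun V G _ _ => P V G) :
    ∃ ψ : FirstOrder.Language.graph.Sentence, ∀ (V : Type w) (G : SimpleGraph V), C V G →
      (P V G ↔ G.SatFO ψ) := by
  obtain ⟨φ, hφ⟩ := hP
  obtain ⟨ψ, hψ⟩ := h φ
  exact ⟨ψ, fun V G hG => (hφ V G _ _).symm.trans (hψ V G hG)⟩

theorem mainTheorem8 (C : GraphClass.{w}) (hC : C.Hereditary)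
    (hpat : ∀ t : ℕ,
      (∃ H : SimpleGraph (Fin t ⊕ Fin t), IsFlippedHalfGraph t H ∧ C.Contains H) ∨
      (∃ H : SimpleGraph (Fin t × Fin t), IsFlippedDisjointPaths t t H ∧ C.Contains H)) :
    C.MSOMoreExpressive := by
  intro hsame
  obtain ⟨ψ₁, hψ₁⟩ := hsame.exists_satFO_iff msoDefinable_hasQuartering
  obtain ⟨ψ₂, hψ₂⟩ := hsame.exists_satFO_iff msoDefinable_hasPairing
  let m := 2 ^ ψ₁.quantifierRank + 2 ^ (ψ₂.quantifierRank + 1) + ψ₂.quantifierRank + 13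
  have h₁ : 0 < 2 ^ ψ₁.quantifierRank := by positivity
  have h₂ : 0 < 2 ^ (ψ₂.quantifierRank + 1) := by positivity
  obtain ⟨H, hH, hCH⟩ | ⟨H, hH, hCH⟩ := hpat (2 * m + 1)
  · obtain ⟨F, hF, rfl⟩ := hH
    exact not_forall_hasQuartering_iff_satFO hC ψ₁ (m := m) (by omega) ⟨F, hF, rfl⟩
      (hC.contains_of_embedding hCH (halfGraphEmbedding (Nat.le_succ _) F hF)) hψ₁
  · exact not_forall_hasPairing_iff_satFO hC ψ₂ (odd_two_mul_add_one m) (by omega) (by omega) hH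
      hCH hψ₂
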